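/- For $c\in\mathbb{C}$ consider the three-node feed-forward ("self-drive") network $$F_c(z_1,z_2,z_3)=\bigl(z_1^2+c,\ (az_1+z_2)^2+c,\ (z_1+z_2+bz_3)^2+c\bigr),\qquad (z_1,z_2,z_3)\in\mathbb{C}^3,$$ with connectivity weights $a=b=-1$, all nodes being updated simultaneously. Its equi-Mandelbrot set $\mathcal{M}$ is the set of all $c\in\mathbb{C}$ for which the critical multi-orbit $\bigl(F_c^{\,t}(0,0,0)\bigr)_{t\ge 0}$ is bounded in $\mathbb{C}^3$. Then $0\in\mathcal{M}$ and $-1\in\mathcal{M}$, no point $c$ with $\mathrm{Re}\,c=-3/4$ belongs to $\mathcal{M}$, and $\mathcal{M}$ is disconnected. -/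

import Mathlib

/-- One step of the network of `n` complex quadratic nodes with weights `g` (`g j l` is the weight
of the edge from node `l` to node `j`) and parameters `c`:
`z_j ↦ (∑_l g_{jl} z_l)² + c_j`, all nodes being updated simultaneously. -/
def networkStep {n : ℕ} (g : Matrix (Fin n) (Fin n) ℂ) (c z : Fin n → ℂ) : Fin n → ℂ :=
  fun j => (∑ l, g j l * z l) ^ 2 + c j

/-- The multi-orbit of the initial state `z`. -/
def multiOrbit {n : ℕ} (g : Matrix (Fin n) (Fin n) ℂ) (c z : Fin n → ℂ) (t : ℕ) : Fin n → ℂ :=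
  (networkStep g c)^[t] z

/-- The multi-Mandelbrot set: the parameters for which the multi-orbit of the critical point
`(0, …, 0)` is bounded in `ℂⁿ`. -/
def multiMandelbrot {n : ℕ} (g : Matrix (Fin n) (Fin n) ℂ) : Set (Fin n → ℂ) :=
  {c | Bornology.IsBounded (Set.range (multiOrbit g c 0))}

/-- The equi-Mandelbrot set: the slice `(c, …, c)` of the multi-Mandelbrot set. -/
def equiMandelbrot {n : ℕ} (g : Matrix (Fin n) (Fin n) ℂ) : Set ℂ :=
  {c | (fun _ => c) ∈ multiMandelbrot g}

/-- The weights of the self-drive network `z₁ → z₁² + c`, `z₂ → (a z₁ + z₂)² + c`,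
`z₃ → (z₁ + z₂ + b z₃)² + c`. -/
def selfDriveWeights (a b : ℂ) : Matrix (Fin 3) (Fin 3) ℂ :=
  !![1, 0, 0; a, 1, 0; 1, 1, b]

/-- The self-drive network is the map written in coordinates. -/
theorem networkStep_selfDriveWeights (a b c : ℂ) (z : Fin 3 → ℂ) :
    networkStep (selfDriveWeights a b) (fun _ => c) z =
      ![z 0 ^ 2 + c, (a * z 0 + z 1) ^ 2 + c, (z 0 + z 1 + b * z 2) ^ 2 + c] := by
  funext j
  fin_cases j <;> simp [networkStep, selfDriveWeights, Fin.sum_univ_three]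

/-! The line `Re c = -3/4` separates the members `-1` and `0`, so it is enough that it misses the
set: the intermediate value theorem for `Complex.re` then rules out connectedness. Where `|Im c| >
2` the first node already escapes. On the remaining segment `‖c‖ ≤ 5/2`, and a bounded orbit keeps
its nodes below 3, 7, 15 (`selfDriveOrbit_norm_lt`). Rigorous ball arithmetic with bisection
(`lineTest_segment`) shows that one of these bounds is always violated. The later nodes are
indispensable: at `c = -3/4` the first node stays bounded. -/

/-! ### Escape criteria -/

/-- A real sequence that gains at least `ε > 0` at every index where it is at least `R`, and is
bounded above, never reaches `R`. -/
theorem lt_of_bddAbove_of_gain {u : ℕ → ℝ} {R ε : ℝ} (hε : 0 < ε)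
    (hgain : ∀ n, R ≤ u n → u n + ε ≤ u (n + 1)) (hbdd : BddAbove (Set.range u)) (n : ℕ) :
    u n < R := by
  by_contra! hn
  obtain ⟨M, hM⟩ := hbdd
  have hgrow : ∀ k : ℕ, R + k * ε ≤ u (n + k) := by
    intro k
    induction k with
    | zero => simpa using hn
    | succ k ih =>
      have hR : R ≤ u (n + k) := le_trans (le_add_of_nonneg_right (by positivity)) ih
      have := hgain _ hR
      push_cast
      rw [← add_assoc]
      linarith
  obtain ⟨k, hk⟩ := exists_nat_gt ((M - R) / ε)
  rw [div_lt_iff₀ hε] at hk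
  have := hM (Set.mem_range_self (n + k))
  linarith [hgrow k]

/-- A bounded orbit of a quadratic node with parameter `‖c‖ ≤ 5 / 2` that receives inputs of norm
at most `K` stays below `K + r` as soon as `r ^ 2 - 5 / 2 ≥ K + r + 1`. -/
theorem norm_lt_of_bounded_driven_orbit {x w : ℕ → ℂ} {c : ℂ} {K r : ℝ} (hc : ‖c‖ ≤ 5 / 2)
    (hx : ∀ n, ‖x (n + 1) - c‖ = ‖w n + x n‖ ^ 2) (hw : ∀ n, ‖w n‖ ≤ K) (hr : 1 ≤ r)
    (hKr : K + r + 1 ≤ r ^ 2 - 5 / 2) (hbdd : BddAbove (Set.range fun n => ‖x n‖)) (n : ℕ) :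
    ‖x n‖ < K + r := by
  -- With `s = ‖x n‖ - K ≥ r ≥ 1`, monotonicity of `s² - s` gives `s² - 5/2 ≥ s + K + 1`, a gain of
  -- 1 per step.
  refine lt_of_bddAbove_of_gain one_pos (fun n hn => ?_) hbdd n
  have h₁ : ‖x n‖ - K ≤ ‖w n + x n‖ := by
    have := norm_sub_le (w n + x n) (w n)
    rw [add_sub_cancel_left] at this
    linarith [hw n]
  have h₂ : ‖x (n + 1) - c‖ ≤ ‖x (n + 1)‖ + ‖c‖ := norm_sub_le _ _
  have h₃ : (‖x n‖ - K) ^ 2 ≤ ‖w n + x n‖ ^ 2 :=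
    pow_le_pow_left₀ (by linarith) h₁ 2
  rw [hx] at h₂
  nlinarith

/-- The critical orbit of `z ↦ z ^ 2 + c` is unbounded if `‖c‖ > 2`. -/
theorem not_bddAbove_critical_orbit {x : ℕ → ℂ} {c : ℂ} (hc : 2 < ‖c‖) (h₀ : x 0 = 0)
    (hx : ∀ n, x (n + 1) = x n ^ 2 + c) : ¬ BddAbove (Set.range fun n => ‖x n‖) := by
  intro hbdd
  have hpos : 0 < ‖c‖ * (‖c‖ - 2) := mul_pos (by linarith) (by linarith)
  -- Index 1 gives the contradiction, since `x 1 = c` has norm exactly `R`.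
  have := lt_of_bddAbove_of_gain (R := ‖c‖) hpos (fun n hn => ?_) hbdd 1
  · simp [hx, h₀] at this
  have h := norm_sub_le (x n ^ 2 + c) c
  rw [add_sub_cancel_right, norm_pow] at h
  simp only [hx]
  nlinarith

/-! ### The coordinates of the self-drive orbit -/

theorem multiOrbit_succ {n : ℕ} (g : Matrix (Fin n) (Fin n) ℂ) (c z : Fin n → ℂ) (t : ℕ) :
    multiOrbit g c z (t + 1) = networkStep g c (multiOrbit g c z t) :=
  Function.iterate_succ_apply' _ _ _

theorem bddAbove_norm_coord {c : ℂ} {n : ℕ} {g : Matrix (Fin n) (Fin n) ℂ}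
    (h : c ∈ equiMandelbrot g) (j : Fin n) :
    BddAbove (Set.range fun t => ‖multiOrbit g (fun _ => c) 0 t j‖) := by
  obtain ⟨M, hM⟩ := isBounded_iff_forall_norm_le.1
    (show Bornology.IsBounded (Set.range (multiOrbit g (fun _ => c) 0)) from h)
  exact ⟨M, by rintro _ ⟨t, rfl⟩; exact (norm_le_pi_norm _ j).trans (hM _ ⟨t, rfl⟩)⟩

/-- The critical multi-orbit of the self-drive network with weights `a = b = -1`. -/
def selfDriveOrbit (c : ℂ) (t : ℕ) : Fin 3 → ℂ :=
  multiOrbit (selfDriveWeights (-1) (-1)) (fun _ => c) 0 t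

theorem selfDriveOrbit_zero (c : ℂ) : selfDriveOrbit c 0 = 0 := rfl

theorem selfDriveOrbit_succ (c : ℂ) (t : ℕ) :
    selfDriveOrbit c (t + 1) =
      ![selfDriveOrbit c t 0 ^ 2 + c, (-selfDriveOrbit c t 0 + selfDriveOrbit c t 1) ^ 2 + c,
        (selfDriveOrbit c t 0 + selfDriveOrbit c t 1 + -selfDriveOrbit c t 2) ^ 2 + c] := by
  simp only [selfDriveOrbit, multiOrbit_succ, networkStep_selfDriveWeights, neg_mul, one_mul]

/-- Along a bounded orbit with `‖c‖ ≤ 5 / 2` the three nodes have norms less than `3`, `7`, `15`. -/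
theorem selfDriveOrbit_norm_lt {c : ℂ} (hc : ‖c‖ ≤ 5 / 2)
    (h : c ∈ equiMandelbrot (selfDriveWeights (-1) (-1))) (t : ℕ) :
    ‖selfDriveOrbit c t 0‖ < 3 ∧ ‖selfDriveOrbit c t 1‖ < 7 ∧ ‖selfDriveOrbit c t 2‖ < 15 := by
  have h₀ : ∀ t, ‖selfDriveOrbit c t 0‖ < 3 := by
    intro t
    have := norm_lt_of_bounded_driven_orbit (x := fun t => selfDriveOrbit c t 0) (w := 0)
      (K := 0) (r := 3) hc (fun n => by simp [selfDriveOrbit_succ]) (fun n => by simp)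
      (by norm_num) (by norm_num) (bddAbove_norm_coord h 0) t
    linarith
  have h₁ : ∀ t, ‖selfDriveOrbit c t 1‖ < 7 := by
    intro t
    have := norm_lt_of_bounded_driven_orbit (x := fun t => selfDriveOrbit c t 1)
      (w := fun t => -selfDriveOrbit c t 0)
      (K := 3) (r := 4) hc (fun n => by simp [selfDriveOrbit_succ])
      (fun n => by simpa using (h₀ n).le)
      (by norm_num) (by norm_num) (bddAbove_norm_coord h 1) t
    linarith
  refine ⟨h₀ t, h₁ t, ?_⟩
  -- The weight `-1` is absorbed by a sign change inside the square; `K = 3 + 7`.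
  have := norm_lt_of_bounded_driven_orbit (x := fun t => selfDriveOrbit c t 2)
    (w := fun t => -(selfDriveOrbit c t 0 + selfDriveOrbit c t 1))
    (K := 10) (r := 5) hc
    (fun n => by
      rw [← norm_neg (-(selfDriveOrbit c n 0 + selfDriveOrbit c n 1) + _)]
      simp [selfDriveOrbit_succ, add_comm])
    (fun n => by
      rw [norm_neg]
      linarith [norm_add_le (selfDriveOrbit c n 0) (selfDriveOrbit c n 1), h₀ n, h₁ n])
    (by norm_num) (by norm_num) (bddAbove_norm_coord h 2) t
  linarith

/-! ### Fixed-point ball arithmetic in the complex plane -/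

/-- A natural number, evaluated before it is passed on. -/
def Nat.evalThen {α : Type*} (n : ℕ) (f : ℕ → α) : α :=
  match n with
  | 0 => f 0
  | k + 1 => f (k + 1)

/-- Logically `evalThen` is plain application; its match makes the kernel reduce the number first,
so unevaluated arithmetic does not pile up in `decide`. -/
theorem Nat.evalThen_eq {α : Type*} (n : ℕ) (f : ℕ → α) : n.evalThen f = f n := by
  cases n <;> rfl

/-- An integer, evaluated before it is passed on. -/
def Int.evalThen {α : Type*} (n : ℤ) (f : ℤ → α) : α :=
  match n with
  | .ofNat k => k.evalThen fun k => f (.ofNat k)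
  | .negSucc k => k.evalThen fun k => f (.negSucc k)

theorem Int.evalThen_eq {α : Type*} (n : ℤ) (f : ℤ → α) : n.evalThen f = f n := by
  cases n <;> simp [Int.evalThen, Nat.evalThen_eq]

/-- A closed ball of `ℂ` whose centre and radius are given in units of `1 / 65536`. -/
structure FixedBall where
  /-- The scaled real part of the centre. -/
  re : ℤ
  /-- The scaled imaginary part of the centre. -/
  im : ℤ
  /-- The scaled radius. -/
  rad : ℕ

namespace FixedBall

/-- The scaled centre of a ball. -/
noncomputable def center (B : FixedBall) : ℂ := ⟨B.re, B.im⟩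

/-- The membership relation of a ball. -/
def Contains (B : FixedBall) (z : ℂ) : Prop := ‖65536 * z - B.center‖ ≤ B.rad

/-- An upper bound for `√(a ^ 2 + b ^ 2)`. -/
def hypotBound (a b : ℕ) : ℕ :=
  bif Nat.ble a b then b + (a + 1) / 2 else a + (b + 1) / 2

/-- A ball that contains the sums of the points of two balls. -/
def add (B C : FixedBall) : FixedBall := ⟨B.re + C.re, B.im + C.im, B.rad + C.rad⟩

/-- The ball of the opposite points. -/
def neg (B : FixedBall) : FixedBall := ⟨-B.re, -B.im, B.rad⟩

/-- A ball that contains the squares of the points of a ball. -/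
def sq (B : FixedBall) : FixedBall :=
  ⟨(B.re * B.re - B.im * B.im) / 65536, 2 * B.re * B.im / 65536,
    B.rad * (2 * hypotBound B.re.natAbs B.im.natAbs + B.rad) / 65536 + 3⟩

/-- A test that the points of the ball have norm at least `R`. -/
def avoids (R : ℕ) (B : FixedBall) : Bool :=
  Nat.ble ((R * 65536 + B.rad) * (R * 65536 + B.rad))
    (B.re.natAbs * B.re.natAbs + B.im.natAbs * B.im.natAbs)

/-- A ball, evaluated before it is passed on. -/
def evalThen {α : Type*} (B : FixedBall) (f : FixedBall → α) : α :=
  B.re.evalThen fun x => B.im.evalThen fun y => B.rad.evalThen fun r => f ⟨x, y, r⟩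

theorem evalThen_eq {α : Type*} (B : FixedBall) (f : FixedBall → α) : B.evalThen f = f B := by
  simp only [evalThen, Int.evalThen_eq, Nat.evalThen_eq]

variable {B C : FixedBall} {z w : ℂ}

theorem Contains.norm_le (h : B.Contains z) : ‖65536 * z - B.center‖ ≤ B.rad := h

theorem Contains.add (hz : B.Contains z) (hw : C.Contains w) : (B.add C).Contains (z + w) := by
  have hcenter : 65536 * (z + w) - (B.add C).center =
      (65536 * z - B.center) + (65536 * w - C.center) := by
    apply Complex.ext <;> simp [center, FixedBall.add] <;> ring
  rw [Contains, hcenter]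
  refine (norm_add_le _ _).trans ?_
  simpa [FixedBall.add] using add_le_add hz.norm_le hw.norm_le

theorem Contains.neg (hz : B.Contains z) : B.neg.Contains (-z) := by
  have hcenter : 65536 * -z - B.neg.center = -(65536 * z - B.center) := by
    apply Complex.ext <;> simp [center, FixedBall.neg] <;> ring
  rw [Contains, hcenter, norm_neg]
  exact hz

theorem norm_center_sq (B : FixedBall) :
    ‖B.center‖ ^ 2 = (B.re : ℝ) * B.re + B.im * B.im := by
  rw [Complex.sq_norm, Complex.normSq_apply, center]

theorem natAbs_mul_self_cast (a : ℤ) : ((a.natAbs : ℕ) : ℝ) * a.natAbs = (a : ℝ) * a := by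
  rw [Nat.cast_natAbs, ← Int.cast_mul, abs_mul_abs_self, Int.cast_mul]

/-- For `a ≤ b`, `(b + a/2)² ≥ b² + ab ≥ b² + a²`, which avoids square roots. -/
theorem sq_add_sq_le_hypotBound (a b : ℕ) :
    (a : ℝ) * a + b * b ≤ (hypotBound a b : ℝ) ^ 2 := by
  have key : ∀ a b : ℕ, a ≤ b → (a : ℝ) * a + b * b ≤ ((b + (a + 1) / 2 : ℕ) : ℝ) ^ 2 := by
    intro a b hab
    have h₁ : (a : ℝ) ≤ b := by exact_mod_cast hab
    have h₂ : (a : ℝ) ≤ 2 * ((a + 1) / 2 : ℕ) := by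
      exact_mod_cast (show a ≤ 2 * ((a + 1) / 2) by omega)
    have h₃ : (0 : ℝ) ≤ a := Nat.cast_nonneg a
    rw [Nat.cast_add]
    nlinarith [mul_le_mul_of_nonneg_left h₁ h₃]
  rw [hypotBound]
  cases h : Nat.ble a b
  · rw [add_comm, cond_false]
    refine key b a (le_of_lt (not_le.1 fun hab => ?_))
    simp [Nat.ble_eq_true_of_le hab] at h
  · exact key a b (Nat.le_of_ble_eq_true h)

theorem norm_center_le (B : FixedBall) :
    ‖B.center‖ ≤ hypotBound B.re.natAbs B.im.natAbs := by
  refine (abs_le_of_sq_le_sq' ?_ (Nat.cast_nonneg _)).2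
  rw [norm_center_sq, ← natAbs_mul_self_cast, ← natAbs_mul_self_cast]
  exact sq_add_sq_le_hypotBound _ _

theorem abs_div_sub_ediv_le (a : ℤ) : |(a : ℝ) / 65536 - (a / 65536 : ℤ)| ≤ 1 := by
  have h₁ : (65536 : ℝ) * (a / 65536 : ℤ) ≤ a := by
    exact_mod_cast (show 65536 * (a / 65536) ≤ a by omega)
  have h₂ : (a : ℝ) ≤ 65536 * (a / 65536 : ℤ) + 65536 := by
    exact_mod_cast (show a ≤ 65536 * (a / 65536) + 65536 by omega)
  rw [abs_le]
  constructor <;> linarith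

/-- Each floored coordinate costs at most 1; flooring the radius costs one more, hence the `+ 3` in
`FixedBall.sq`. -/
theorem norm_center_sq_sub_le (B : FixedBall) : ‖B.center ^ 2 / 65536 - B.sq.center‖ ≤ 2 := by
  have hre : (B.center ^ 2 / 65536 - B.sq.center).re =
      ((B.re * B.re - B.im * B.im : ℤ) : ℝ) / 65536 -
        ((B.re * B.re - B.im * B.im) / 65536 : ℤ) := by
    rw [Complex.sub_re, Complex.div_ofNat_re]
    simp [center, FixedBall.sq, pow_two]
  have him : (B.center ^ 2 / 65536 - B.sq.center).im =
      ((2 * B.re * B.im : ℤ) : ℝ) / 65536 - (2 * B.re * B.im / 65536 : ℤ) := by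
    rw [Complex.sub_im, Complex.div_ofNat_im]
    simp [center, FixedBall.sq, pow_two]
    ring
  refine (Complex.norm_le_abs_re_add_abs_im _).trans ?_
  rw [hre, him]
  linarith [abs_div_sub_ediv_le (B.re * B.re - B.im * B.im),
    abs_div_sub_ediv_le (2 * B.re * B.im)]

theorem Contains.sq (hz : B.Contains z) : B.sq.Contains (z ^ 2) := by
  set N := hypotBound B.re.natAbs B.im.natAbs with hN
  have hsplit : 65536 * z ^ 2 - B.sq.center =
      (65536 * z - B.center) * (2 * B.center + (65536 * z - B.center)) / 65536 +
        (B.center ^ 2 / 65536 - B.sq.center) := by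
    ring
  have hsum : ‖2 * B.center + (65536 * z - B.center)‖ ≤ 2 * N + B.rad := by
    refine (norm_add_le _ _).trans (add_le_add ?_ hz)
    rw [norm_mul, Complex.norm_ofNat]
    exact mul_le_mul_of_nonneg_left B.norm_center_le zero_le_two
  have hprod : ‖(65536 * z - B.center) * (2 * B.center + (65536 * z - B.center)) / 65536‖ ≤
      (B.rad : ℝ) * (2 * N + B.rad) / 65536 := by
    rw [norm_div, norm_mul, Complex.norm_ofNat]
    exact div_le_div_of_nonneg_right
      (mul_le_mul hz.norm_le hsum (norm_nonneg _) (Nat.cast_nonneg _)) (by norm_num)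
  have hround : (B.rad : ℝ) * (2 * N + B.rad) ≤
      65536 * (B.rad * (2 * N + B.rad) / 65536 : ℕ) + 65536 := by
    have : B.rad * (2 * N + B.rad) ≤ 65536 * (B.rad * (2 * N + B.rad) / 65536) + 65536 := by
      omega
    exact_mod_cast this
  have hrad : (B.sq.rad : ℝ) = (B.rad * (2 * N + B.rad) / 65536 : ℕ) + 3 := by
    rw [FixedBall.sq, ← hN, Nat.cast_add, Nat.cast_ofNat]
  rw [Contains, hsplit, hrad]
  refine (norm_add_le _ _).trans ?_
  linarith [B.norm_center_sq_sub_le]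

theorem Contains.le_norm_of_avoids {R : ℕ} (hz : B.Contains z) (h : B.avoids R) : R ≤ ‖z‖ := by
  have hsq : ((R : ℝ) * 65536 + B.rad) ^ 2 ≤ ‖B.center‖ ^ 2 := by
    rw [norm_center_sq, ← natAbs_mul_self_cast, ← natAbs_mul_self_cast, pow_two]
    exact_mod_cast Nat.le_of_ble_eq_true h
  have hle : (R : ℝ) * 65536 + B.rad ≤ ‖B.center‖ :=
    (abs_le_of_sq_le_sq' hsq (norm_nonneg _)).2
  have htri := norm_sub_le (65536 * z) (65536 * z - B.center)
  rw [sub_sub_cancel, norm_mul, Complex.norm_ofNat] at htri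
  linarith [hz.norm_le]

theorem contains_zero : (⟨0, 0, 0⟩ : FixedBall).Contains 0 := by
  have : (⟨0, 0, 0⟩ : FixedBall).center = 0 := by apply Complex.ext <;> simp [center]
  simp [Contains, this]

end FixedBall

/-! ### The escape test on the line `Re c = -3 / 4` -/

/-- A test that, from every state in `B₀ × B₁ × B₂` and for every parameter in `C`, the self-drive
orbit reaches norm `3`, `7` or `15` at the respective node within `n` further steps. -/
def escapeTest (C : FixedBall) : ℕ → FixedBall → FixedBall → FixedBall → Bool
  | 0, B₀, B₁, B₂ => B₀.avoids 3 || B₁.avoids 7 || B₂.avoids 15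
  | n + 1, B₀, B₁, B₂ => B₀.avoids 3 || B₁.avoids 7 || B₂.avoids 15 ||
      (B₀.sq.add C).evalThen fun B₀' => ((B₀.neg.add B₁).sq.add C).evalThen fun B₁' =>
        (((B₀.add B₁).add B₂.neg).sq.add C).evalThen fun B₂' => escapeTest C n B₀' B₁' B₂'

/-- A test that the parameters `-3 / 4 + y * I` with `|65536 * y - m| ≤ 2 ^ n` escape, with at most
`n` bisections. -/
def lineTest : ℕ → ℤ → Bool
  | 0, _ => false
  | n + 1, m =>
      escapeTest ⟨-49152, m, 2 ^ (n + 1)⟩ 8 ⟨0, 0, 0⟩ ⟨0, 0, 0⟩ ⟨0, 0, 0⟩ ||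
        ((m - 2 ^ n).evalThen (lineTest n) && (m + 2 ^ n).evalThen (lineTest n))

theorem exists_large_of_escapeTest {C : FixedBall} {c : ℂ} (hc : C.Contains c) {n t : ℕ}
    {B₀ B₁ B₂ : FixedBall} (h₀ : B₀.Contains (selfDriveOrbit c t 0))
    (h₁ : B₁.Contains (selfDriveOrbit c t 1)) (h₂ : B₂.Contains (selfDriveOrbit c t 2))
    (h : escapeTest C n B₀ B₁ B₂) :
    ∃ s, 3 ≤ ‖selfDriveOrbit c s 0‖ ∨ 7 ≤ ‖selfDriveOrbit c s 1‖ ∨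
      15 ≤ ‖selfDriveOrbit c s 2‖ := by
  have now : (B₀.avoids 3 || B₁.avoids 7 || B₂.avoids 15) = true →
      ∃ s, 3 ≤ ‖selfDriveOrbit c s 0‖ ∨ 7 ≤ ‖selfDriveOrbit c s 1‖ ∨
        15 ≤ ‖selfDriveOrbit c s 2‖ := by
    intro hn
    simp only [Bool.or_eq_true] at hn
    rcases hn with (hn | hn) | hn
    · exact ⟨t, Or.inl (by exact_mod_cast h₀.le_norm_of_avoids hn)⟩
    · exact ⟨t, Or.inr (Or.inl (by exact_mod_cast h₁.le_norm_of_avoids hn))⟩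
    · exact ⟨t, Or.inr (Or.inr (by exact_mod_cast h₂.le_norm_of_avoids hn))⟩
  induction n generalizing t B₀ B₁ B₂ with
  | zero => exact now h
  | succ n ih =>
    rw [escapeTest, Bool.or_eq_true] at h
    rcases h with h | h
    · exact now h
    · simp only [FixedBall.evalThen_eq] at h
      have step := selfDriveOrbit_succ c t
      have h₀' : (B₀.sq.add C).Contains (selfDriveOrbit c (t + 1) 0) := by
        simpa [step] using h₀.sq.add hc
      have h₁' : ((B₀.neg.add B₁).sq.add C).Contains (selfDriveOrbit c (t + 1) 1) := by
        simpa [step] using (h₀.neg.add h₁).sq.add hc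
      have h₂' : (((B₀.add B₁).add B₂.neg).sq.add C).Contains (selfDriveOrbit c (t + 1) 2) := by
        simpa [step] using ((h₀.add h₁).add h₂.neg).sq.add hc
      -- The induction hypothesis carries `now` as a premise, to be proved again at time `t + 1`.
      refine ih h₀' h₁' h₂' h (fun hn => ?_)
      simp only [Bool.or_eq_true] at hn
      rcases hn with (hn | hn) | hn
      · exact ⟨t + 1, Or.inl (by exact_mod_cast h₀'.le_norm_of_avoids hn)⟩
      · exact ⟨t + 1, Or.inr (Or.inl (by exact_mod_cast h₁'.le_norm_of_avoids hn))⟩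
      · exact ⟨t + 1, Or.inr (Or.inr (by exact_mod_cast h₂'.le_norm_of_avoids hn))⟩

theorem exists_large_of_lineTest {n : ℕ} {m : ℤ} (h : lineTest n m) {c : ℂ}
    (hre : c.re = -3 / 4) (him : |65536 * c.im - m| ≤ 2 ^ n) :
    ∃ s, 3 ≤ ‖selfDriveOrbit c s 0‖ ∨ 7 ≤ ‖selfDriveOrbit c s 1‖ ∨
      15 ≤ ‖selfDriveOrbit c s 2‖ := by
  induction n generalizing m with
  | zero => simp [lineTest] at h
  | succ n ih =>
    rw [lineTest, Bool.or_eq_true, Bool.and_eq_true, Int.evalThen_eq, Int.evalThen_eq] at h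
    rcases h with h | ⟨hl, hr⟩
    · refine exists_large_of_escapeTest (t := 0) ?_ ?_ ?_ ?_ h
      · have : 65536 * c - FixedBall.center ⟨-49152, m, 2 ^ (n + 1)⟩ =
            ((65536 * c.im - m : ℝ) : ℂ) * Complex.I := by
          apply Complex.ext <;> simp [FixedBall.center, hre]
          norm_num
        rw [FixedBall.Contains, this, norm_mul, Complex.norm_I, mul_one, Complex.norm_real]
        exact_mod_cast him
      all_goals exact FixedBall.contains_zero
    · rw [abs_le, pow_succ] at him
      rcases le_total (65536 * c.im) m with hm | hm
      · refine ih hl (abs_le.2 ?_)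
        push_cast
        constructor <;> linarith
      · refine ih hr (abs_le.2 ?_)
        push_cast
        constructor <;> linarith

/-- The weights are real; this leaves only `Im c ≥ 0` to be tested. -/
theorem selfDriveOrbit_conj (c : ℂ) (t : ℕ) (j : Fin 3) :
    selfDriveOrbit (starRingEnd ℂ c) t j = starRingEnd ℂ (selfDriveOrbit c t j) := by
  induction t generalizing j with
  | zero => simp [selfDriveOrbit_zero]
  | succ t ih =>
    rw [selfDriveOrbit_succ, selfDriveOrbit_succ]
    fin_cases j <;> simp [ih]

/-- Centre 65536 and radius `2 ^ 16` stand for `0 ≤ Im c ≤ 2`. -/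
theorem lineTest_segment : lineTest 16 65536 = true := by
  decide +kernel

theorem exists_large_of_re {c : ℂ} (hre : c.re = -3 / 4) (him : |c.im| ≤ 2) :
    ∃ s, 3 ≤ ‖selfDriveOrbit c s 0‖ ∨ 7 ≤ ‖selfDriveOrbit c s 1‖ ∨
      15 ≤ ‖selfDriveOrbit c s 2‖ := by
  have upper : ∀ c : ℂ, c.re = -3 / 4 → |c.im| ≤ 2 → 0 ≤ c.im →
      ∃ s, 3 ≤ ‖selfDriveOrbit c s 0‖ ∨ 7 ≤ ‖selfDriveOrbit c s 1‖ ∨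
        15 ≤ ‖selfDriveOrbit c s 2‖ := by
    intro c hre him hpos
    refine exists_large_of_lineTest lineTest_segment hre (abs_le.2 ?_)
    rw [abs_le] at him
    push_cast
    constructor <;> linarith
  rcases le_total 0 c.im with h | h
  · exact upper c hre him h
  · simpa only [selfDriveOrbit_conj, Complex.norm_conj] using
      upper (starRingEnd ℂ c) (by simpa using hre) (by simpa using him) (by simpa using h)

/-- No parameter on the line `Re c = -3 / 4` belongs to the equi-Mandelbrot set. -/
theorem notMem_equiMandelbrot_of_re {c : ℂ} (hre : c.re = -3 / 4) :
    c ∉ equiMandelbrot (selfDriveWeights (-1) (-1)) := by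
  intro h
  rcases le_or_gt |c.im| 2 with him | him
  · have hc : ‖c‖ ≤ 5 / 2 := by
      refine (abs_le_of_sq_le_sq' ?_ (by norm_num)).2
      rw [Complex.sq_norm, Complex.normSq_apply, hre]
      nlinarith [abs_le.1 him]
    obtain ⟨s, hs⟩ := exists_large_of_re hre him
    obtain ⟨h₀, h₁, h₂⟩ := selfDriveOrbit_norm_lt hc h s
    rcases hs with hs | hs | hs <;> linarith
  · exact not_bddAbove_critical_orbit (x := fun t => selfDriveOrbit c t 0)
      (him.trans_le (Complex.abs_im_le_norm c)) rfl (fun t => by simp [selfDriveOrbit_succ])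
      (bddAbove_norm_coord h 0)

/-! ### Two parameters with periodic critical orbit -/

/-- A parameter whose critical multi-orbit is periodic belongs to the equi-Mandelbrot set. -/
theorem mem_equiMandelbrot_of_isPeriodicPt {n : ℕ} {g : Matrix (Fin n) (Fin n) ℂ} {c : ℂ} {p : ℕ}
    (hp : 0 < p) (h : Function.IsPeriodicPt (networkStep g fun _ => c) p 0) :
    c ∈ equiMandelbrot g := by
  refine Set.Finite.isBounded (((Finset.range p).finite_toSet.image
    (multiOrbit g (fun _ => c) 0)).subset ?_)
  rintro _ ⟨t, rfl⟩
  exact ⟨t % p, by simpa using Nat.mod_lt t hp, h.iterate_mod_apply t⟩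

theorem zero_mem_equiMandelbrot_selfDrive :
    (0 : ℂ) ∈ equiMandelbrot (selfDriveWeights (-1) (-1)) := by
  refine mem_equiMandelbrot_of_isPeriodicPt one_pos ?_
  change networkStep _ _ _ = _
  rw [networkStep_selfDriveWeights]
  funext j
  fin_cases j <;> simp

theorem neg_one_mem_equiMandelbrot_selfDrive :
    (-1 : ℂ) ∈ equiMandelbrot (selfDriveWeights (-1) (-1)) := by
  -- The first node has period 2, but the second runs through `0, -1, -1, 0`.
  refine mem_equiMandelbrot_of_isPeriodicPt (p := 4) (by norm_num) ?_
  change networkStep _ _ (networkStep _ _ (networkStep _ _ (networkStep _ _ _))) = _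
  simp only [networkStep_selfDriveWeights]
  funext j
  fin_cases j <;> simp

theorem mainTheorem2 :
    (0 : ℂ) ∈ equiMandelbrot (selfDriveWeights (-1) (-1)) ∧
    (-1 : ℂ) ∈ equiMandelbrot (selfDriveWeights (-1) (-1)) ∧
    (∀ c : ℂ, c.re = -3 / 4 → c ∉ equiMandelbrot (selfDriveWeights (-1) (-1))) ∧
    ¬ IsPreconnected (equiMandelbrot (selfDriveWeights (-1) (-1))) := by
  refine ⟨zero_mem_equiMandelbrot_selfDrive, neg_one_mem_equiMandelbrot_selfDrive,
    fun c => notMem_equiMandelbrot_of_re, fun hconn => ?_⟩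
  obtain ⟨c, hc, hre⟩ := hconn.intermediate_value neg_one_mem_equiMandelbrot_selfDrive
    zero_mem_equiMandelbrot_selfDrive Complex.continuous_re.continuousOn
    (show (-3 / 4 : ℝ) ∈ Set.Icc (-1 : ℂ).re (0 : ℂ).re by constructor <;> norm_num)
  exact notMem_equiMandelbrot_of_re hre hc
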